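/- Let $A$ be an associative algebra over $\mathbb C$, with or without unit, with non-degenerate product, and let $M(A)$ denote its multiplier algebra. Let $(A,\Delta)$ be a regular multiplier Hopf algebra: $\Delta:A\to M(A\otimes A)$ is a non-degenerate coassociative homomorphism such that $\Delta(a)(1\otimes b)$, $(a\otimes 1)\Delta(b)$, $\Delta(a)(b\otimes 1)$ and $(1\otimes a)\Delta(b)$ lie in $A\otimes A$ for all $a,b\in A$, and there are a counit, that is, a homomorphism $\varepsilon:A\to\mathbb C$ with $(\varepsilon\otimes\iota)(\Delta(a)(1\otimes b))=ab=(\iota\otimes\varepsilon)((a\otimes 1)\Delta(b))$, and an invertible antipode, that is, a bijective linear anti-homomorphism $S:A\to A$ with $m(S\otimes\iota)(\Delta(a)(1\otimes b))=\varepsilon(a)b$ and $m(\iota\otimes S)((a\otimes 1)\Delta(b))=\varepsilon(b)a$, where $\iota$ is the identity map and $m$ is the multiplication. Assume that $(A,\Delta)$ is an algebraic quantum group, that is, it has a left integral $\varphi$ (a non-zero linear functional with $(\iota\otimes\varphi)\Delta(a)=\varphi(a)1$ in $M(A)$ for all $a\in A$), and let $\psi$ be a right integral (a non-zero linear functional with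 $(\psi\otimes\iota)\Delta(a)=\psi(a)1$ in $M(A)$ for all $a\in A$). Let $\sigma$ and $\sigma'$ be the modular automorphisms, that is, the algebra automorphisms of $A$ such that $$\varphi(ab)=\varphi(b\sigma(a)),\qquad \psi(ab)=\psi(b\sigma'(a))\qquad (a,b\in A),$$ and let $\delta\in M(A)$ be the modular element, that is, the element with $(\varphi\otimes\iota)\Delta(a)=\varphi(a)\delta$ for all $a\in A$. Then: - $\sigma\circ S\circ\sigma'=S$; - $\delta\,\sigma(a)=\sigma'(a)\,\delta$ in $M(A)$ for all $a\in A$; - $\Delta(\sigma(a))=(S^2\otimes\sigma)\Delta(a)$ for all $a\in A$, where the automorphism $S^2\otimes\sigma$ of $A\otimes A$ is extended to $M(A\otimes A)$. -/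

import Mathlib

open scoped TensorProduct

noncomputable section

namespace AlgQuantumGroup

/-! ### Multiplier algebras -/

section MultiplierAlgebra

variable (B : Type*) [NonUnitalRing B] [Module ℂ B] [IsScalarTower ℂ B B] [SMulCommClass ℂ B B]

/-- The product of `B` is non-degenerate. -/
structure NonDegenerate : Prop where
  eq_zero_of_mul_left : ∀ a : B, (∀ b : B, a * b = 0) → a = 0
  eq_zero_of_mul_right : ∀ a : B, (∀ b : B, b * a = 0) → a = 0

/-- The multiplier algebra `M(B)`: the algebra of double centralizers `m = (L, R)`, where `L` is
the left multiplication `x ↦ m x` and `R` is the right multiplication `x ↦ x m`. Since the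
product in `M(B)` is `x (m n) = (x m) n`, the right multiplications live in the opposite of the
algebra of linear endomorphisms. -/
def multiplierSubalgebra : Subalgebra ℂ (Module.End ℂ B × (Module.End ℂ B)ᵐᵒᵖ) where
  carrier := {m | (∀ x y : B, m.1 (x * y) = m.1 x * y) ∧
    (∀ x y : B, m.2.unop (x * y) = x * m.2.unop y) ∧
    (∀ x y : B, m.2.unop x * y = x * m.1 y)}
  mul_mem' := by
    rintro m n ⟨h1, h2, h3⟩ ⟨k1, k2, k3⟩
    refine ⟨fun x y => ?_, fun x y => ?_, fun x y => ?_⟩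
    · simp [k1, h1]
    · simp [h2, k2]
    · simp [h3, k3]
  add_mem' := by
    rintro m n ⟨h1, h2, h3⟩ ⟨k1, k2, k3⟩
    refine ⟨fun x y => ?_, fun x y => ?_, fun x y => ?_⟩
    · simp [k1, h1, add_mul]
    · simp [h2, k2, mul_add]
    · simp [h3, k3, add_mul, mul_add]
  algebraMap_mem' := by
    intro r
    refine ⟨fun x y => ?_, fun x y => ?_, fun x y => ?_⟩
    · simp [Algebra.algebraMap_eq_smul_one, smul_mul_assoc]
    · simp [Algebra.algebraMap_eq_smul_one, mul_smul_comm]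
    · simp [Algebra.algebraMap_eq_smul_one, smul_mul_assoc, mul_smul_comm]

/-- The multiplier algebra `M(B)`, a unital complex algebra. -/
abbrev Multiplier : Type _ := multiplierSubalgebra B

variable {B}

namespace Multiplier

/-- `m.left x` is `m x`. -/
def left (m : Multiplier B) : B →ₗ[ℂ] B := m.1.1

/-- `m.right x` is `x m`. -/
def right (m : Multiplier B) : B →ₗ[ℂ] B := m.1.2.unop

theorem left_mul_apply (m : Multiplier B) (x y : B) : m.left (x * y) = m.left x * y :=
  m.2.1 x y

theorem right_mul_apply (m : Multiplier B) (x y : B) : m.right (x * y) = x * m.right y :=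
  m.2.2.1 x y

theorem right_mul (m : Multiplier B) (x y : B) : m.right x * y = x * m.left y :=
  m.2.2.2 x y

/-- The multiplier with given left and right multiplication. -/
def mk (L R : B →ₗ[ℂ] B) (hL : ∀ x y, L (x * y) = L x * y) (hR : ∀ x y, R (x * y) = x * R y)
    (hRL : ∀ x y, R x * y = x * L y) : Multiplier B :=
  ⟨(L, MulOpposite.op R), hL, hR, hRL⟩

theorem ext {m n : Multiplier B} (hl : ∀ x, m.left x = n.left x)
    (hr : ∀ x, m.right x = n.right x) : m = n :=
  Subtype.ext (Prod.ext (LinearMap.ext hl) (MulOpposite.unop_injective (LinearMap.ext hr)))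

/-- The canonical embedding of `B` in `M(B)`. -/
def incl (b : B) : Multiplier B :=
  mk (LinearMap.mulLeft ℂ b) (LinearMap.mulRight ℂ b)
    (fun x y => by simp [mul_assoc]) (fun x y => by simp [mul_assoc])
    (fun x y => by simp [mul_assoc])

theorem incl_injective (hB : NonDegenerate B) : Function.Injective (incl (B := B)) := by
  intro a b hab
  refine sub_eq_zero.mp (hB.eq_zero_of_mul_left _ fun x => ?_)
  have h : (incl a).left x = (incl b).left x := by rw [hab]
  have h' : a * x = b * x := h
  rw [sub_mul, h', sub_self]

theorem left_mul_left (m n : Multiplier B) (x : B) : (m * n).left x = m.left (n.left x) := rfl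

theorem right_mul_right (m n : Multiplier B) (x : B) :
    (m * n).right x = n.right (m.right x) := rfl

theorem mul_incl (m : Multiplier B) (b : B) : m * incl b = incl (m.left b) :=
  ext (fun x => left_mul_apply m b x) (fun x => right_mul m x b)

theorem incl_mul (m : Multiplier B) (b : B) : incl b * m = incl (m.right b) :=
  ext (fun x => (right_mul m b x).symm) (fun x => right_mul_apply m x b)

end Multiplier

/-- Automorphisms of the complex algebra `B`, which need not have a unit. -/
structure AlgAut (B : Type*) [NonUnitalRing B] [Module ℂ B] extends B ≃ₗ[ℂ] B where
  map_mul' : ∀ x y : B, toFun (x * y) = toFun x * toFun y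

namespace AlgAut

instance : CoeFun (AlgAut B) (fun _ => B → B) := ⟨fun θ => θ.toLinearEquiv⟩

theorem map_mul (θ : AlgAut B) (x y : B) : θ (x * y) = θ x * θ y := θ.map_mul' x y

theorem symm_map_mul (θ : AlgAut B) (x y : B) :
    θ.toLinearEquiv.symm (x * y) = θ.toLinearEquiv.symm x * θ.toLinearEquiv.symm y := by
  apply θ.toLinearEquiv.injective
  have h := θ.map_mul (θ.toLinearEquiv.symm x) (θ.toLinearEquiv.symm y)
  simp only [LinearEquiv.apply_symm_apply] at h ⊢
  exact h.symm

/-- The canonical extension of an automorphism `θ` of `B` to the multiplier algebra: it is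
determined by `θ(m) θ(x) = θ(m x)` and `θ(x) θ(m) = θ(x m)` for `x` in `B`. -/
def extend (θ : AlgAut B) (m : Multiplier B) : Multiplier B :=
  Multiplier.mk
    (θ.toLinearEquiv.toLinearMap ∘ₗ m.left ∘ₗ θ.toLinearEquiv.symm.toLinearMap)
    (θ.toLinearEquiv.toLinearMap ∘ₗ m.right ∘ₗ θ.toLinearEquiv.symm.toLinearMap)
    (fun x y => by
      have h := θ.map_mul (m.left (θ.toLinearEquiv.symm x)) (θ.toLinearEquiv.symm y)
      simp only [LinearEquiv.apply_symm_apply] at h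
      simp [symm_map_mul, Multiplier.left_mul_apply, h])
    (fun x y => by
      have h := θ.map_mul (θ.toLinearEquiv.symm x) (m.right (θ.toLinearEquiv.symm y))
      simp only [LinearEquiv.apply_symm_apply] at h
      simp [symm_map_mul, Multiplier.right_mul_apply, h])
    (fun x y => by
      have h := θ.map_mul (m.right (θ.toLinearEquiv.symm x)) (θ.toLinearEquiv.symm y)
      have k := θ.map_mul (θ.toLinearEquiv.symm x) (m.left (θ.toLinearEquiv.symm y))
      rw [Multiplier.right_mul] at h
      simp only [LinearEquiv.apply_symm_apply] at h k
      simpa using h.symm.trans k)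

end AlgAut

end MultiplierAlgebra

/-! ### Tensor products -/

section Tensor

variable {A : Type*} [NonUnitalRing A] [Module ℂ A] [IsScalarTower ℂ A A] [SMulCommClass ℂ A A]

/-- The element `m ⊗ n` of `M(A ⊗ A)`, for `m` and `n` in `M(A)`. -/
def Multiplier.tmul (m n : Multiplier A) : Multiplier (A ⊗[ℂ] A) :=
  Multiplier.mk (TensorProduct.map m.left n.left) (TensorProduct.map m.right n.right)
    (fun x y => by
      induction x with
      | zero => simp
      | add x x' hx hx' => simp only [add_mul, map_add, hx, hx']
      | tmul a b =>
        induction y with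
        | zero => simp
        | add y y' hy hy' => simp only [mul_add, map_add, hy, hy']
        | tmul c d => simp [Multiplier.left_mul_apply])
    (fun x y => by
      induction x with
      | zero => simp
      | add x x' hx hx' => simp only [add_mul, map_add, hx, hx']
      | tmul a b =>
        induction y with
        | zero => simp
        | add y y' hy hy' => simp only [mul_add, map_add, hy, hy']
        | tmul c d => simp [Multiplier.right_mul_apply])
    (fun x y => by
      induction x with
      | zero => simp
      | add x x' hx hx' => simp only [add_mul, map_add, hx, hx']
      | tmul a b =>
        induction y with
        | zero => simp
        | add y y' hy hy' => simp only [mul_add, map_add, hy, hy']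
        | tmul c d => simp [Multiplier.right_mul])

/-- The element `a ⊗ 1` of `M(A ⊗ A)`. -/
def inFst (a : A) : Multiplier (A ⊗[ℂ] A) := Multiplier.tmul (Multiplier.incl a) 1

/-- The element `1 ⊗ a` of `M(A ⊗ A)`. -/
def inSnd (a : A) : Multiplier (A ⊗[ℂ] A) := Multiplier.tmul 1 (Multiplier.incl a)

/-- The automorphism `α ⊗ β` of `A ⊗ A`. -/
def AlgAut.tensor (α β : AlgAut A) : AlgAut (A ⊗[ℂ] A) where
  toLinearEquiv := TensorProduct.congr α.toLinearEquiv β.toLinearEquiv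
  map_mul' x y := by
    change TensorProduct.congr α.toLinearEquiv β.toLinearEquiv (x * y) =
      TensorProduct.congr α.toLinearEquiv β.toLinearEquiv x *
      TensorProduct.congr α.toLinearEquiv β.toLinearEquiv y
    induction x with
    | zero => simp
    | add x x' hx hx' => simp only [add_mul, map_add, hx, hx']
    | tmul a b =>
      induction y with
      | zero => simp
      | add y y' hy hy' => simp only [mul_add, map_add, hy, hy']
      | tmul c d => simp [AlgAut.map_mul]

/-- The map `ι ⊗ f` from `A ⊗ A` to `A`, for a linear functional `f`. -/
def evalSnd (f : A →ₗ[ℂ] ℂ) : A ⊗[ℂ] A →ₗ[ℂ] A :=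
  (TensorProduct.rid ℂ A).toLinearMap ∘ₗ f.lTensor A

/-- The map `f ⊗ ι` from `A ⊗ A` to `A`, for a linear functional `f`. -/
def evalFst (f : A →ₗ[ℂ] ℂ) : A ⊗[ℂ] A →ₗ[ℂ] A :=
  (TensorProduct.lid ℂ A).toLinearMap ∘ₗ f.rTensor A

@[simp] theorem evalSnd_tmul (f : A →ₗ[ℂ] ℂ) (a b : A) : evalSnd f (a ⊗ₜ b) = f b • a := by
  simp [evalSnd]

@[simp] theorem evalFst_tmul (f : A →ₗ[ℂ] ℂ) (a b : A) : evalFst f (a ⊗ₜ b) = f a • b := by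
  simp [evalFst]

theorem inFst_left_tmul (c a b : A) : (inFst c).left (a ⊗ₜ b) = (c * a) ⊗ₜ b := rfl

theorem inFst_right_tmul (c a b : A) : (inFst c).right (a ⊗ₜ b) = (a * c) ⊗ₜ b := rfl

theorem inSnd_left_tmul (c a b : A) : (inSnd c).left (a ⊗ₜ b) = a ⊗ₜ (c * b) := rfl

theorem inSnd_right_tmul (c a b : A) : (inSnd c).right (a ⊗ₜ b) = a ⊗ₜ (b * c) := rfl

theorem evalSnd_inFst_left (f : A →ₗ[ℂ] ℂ) (c : A) (x : A ⊗[ℂ] A) :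
    evalSnd f ((inFst c).left x) = c * evalSnd f x := by
  induction x with
  | zero => simp
  | add x y hx hy => simp only [map_add, mul_add, hx, hy]
  | tmul a b => simp [inFst_left_tmul, mul_smul_comm]

theorem evalSnd_inFst_right (f : A →ₗ[ℂ] ℂ) (c : A) (x : A ⊗[ℂ] A) :
    evalSnd f ((inFst c).right x) = evalSnd f x * c := by
  induction x with
  | zero => simp
  | add x y hx hy => simp only [map_add, add_mul, hx, hy]
  | tmul a b => simp [inFst_right_tmul, smul_mul_assoc]

theorem evalFst_inSnd_left (f : A →ₗ[ℂ] ℂ) (c : A) (x : A ⊗[ℂ] A) :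
    evalFst f ((inSnd c).left x) = c * evalFst f x := by
  induction x with
  | zero => simp
  | add x y hx hy => simp only [map_add, mul_add, hx, hy]
  | tmul a b => simp [inSnd_left_tmul, mul_smul_comm]

theorem evalFst_inSnd_right (f : A →ₗ[ℂ] ℂ) (c : A) (x : A ⊗[ℂ] A) :
    evalFst f ((inSnd c).right x) = evalFst f x * c := by
  induction x with
  | zero => simp
  | add x y hx hy => simp only [map_add, add_mul, hx, hy]
  | tmul a b => simp [inSnd_right_tmul, smul_mul_assoc]

theorem eq_zero_of_evalFst {x : A ⊗[ℂ] A} (h : ∀ f : A →ₗ[ℂ] ℂ, evalFst f x = 0) : x = 0 := by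
  let b := Module.Free.chooseBasis ℂ A
  apply (TensorProduct.equivFinsuppOfBasisLeft (N := A) b).injective
  rw [map_zero]
  ext i
  rw [TensorProduct.equivFinsuppOfBasisLeft_apply]
  exact h (b.coord i)

theorem eq_zero_of_evalSnd {x : A ⊗[ℂ] A} (h : ∀ f : A →ₗ[ℂ] ℂ, evalSnd f x = 0) : x = 0 := by
  let b := Module.Free.chooseBasis ℂ A
  apply (TensorProduct.equivFinsuppOfBasisRight (M := A) b).injective
  rw [map_zero]
  ext i
  rw [TensorProduct.equivFinsuppOfBasisRight_apply]
  exact h (b.coord i)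

theorem tmul_tmul_eq_left (b c : A) (x : A ⊗[ℂ] A) :
    (b ⊗ₜ[ℂ] c) * x = (inFst b).left ((inSnd c).left x) := by
  induction x with
  | zero => simp
  | add x y hx hy => simp only [map_add, mul_add, hx, hy]
  | tmul p q => simp [inFst_left_tmul, inSnd_left_tmul]

theorem tmul_tmul_eq_right (b c : A) (x : A ⊗[ℂ] A) :
    x * (b ⊗ₜ[ℂ] c) = (inSnd c).right ((inFst b).right x) := by
  induction x with
  | zero => simp
  | add x y hx hy => simp only [map_add, add_mul, hx, hy]
  | tmul p q => simp [inFst_right_tmul, inSnd_right_tmul]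

theorem inFst_inSnd_comm (b c : A) : inFst b * inSnd c = inSnd c * inFst b := by
  refine Multiplier.ext (fun x => ?_) (fun x => ?_)
  · rw [Multiplier.left_mul_left, Multiplier.left_mul_left]
    induction x with
    | zero => simp
    | add x y hx hy => simp only [map_add, hx, hy]
    | tmul p q => simp [inFst_left_tmul, inSnd_left_tmul]
  · rw [Multiplier.right_mul_right, Multiplier.right_mul_right]
    induction x with
    | zero => simp
    | add x y hx hy => simp only [map_add, hx, hy]
    | tmul p q => simp [inFst_right_tmul, inSnd_right_tmul]

theorem NonDegenerate.tensor (hA : NonDegenerate A) : NonDegenerate (A ⊗[ℂ] A) where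
  eq_zero_of_mul_left x hx := by
    have key : ∀ b : A, (inFst b).right x = 0 := fun b => eq_zero_of_evalFst fun f =>
      hA.eq_zero_of_mul_left _ fun c => by
        rw [← evalFst_inSnd_right, ← tmul_tmul_eq_right, hx, map_zero]
    exact eq_zero_of_evalSnd fun f => hA.eq_zero_of_mul_left _ fun b => by
      rw [← evalSnd_inFst_right, key, map_zero]
  eq_zero_of_mul_right x hx := by
    have key : ∀ c : A, (inSnd c).left x = 0 := fun c => eq_zero_of_evalSnd fun f =>
      hA.eq_zero_of_mul_right _ fun b => by
        rw [← evalSnd_inFst_left, ← tmul_tmul_eq_left, hx, map_zero]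
    exact eq_zero_of_evalFst fun f => hA.eq_zero_of_mul_right _ fun c => by
      rw [← evalFst_inSnd_left, key, map_zero]

end Tensor

/-! ### Regular multiplier Hopf algebras -/

/-- A regular multiplier Hopf algebra `(A, Δ)` over the complex numbers.

The maps `T₁`, `T₂`, `T₃`, `T₄` express that the multipliers `Δ(a)(1 ⊗ b)`, `(a ⊗ 1)Δ(b)`,
`Δ(a)(b ⊗ 1)` and `(1 ⊗ a)Δ(b)` lie in `A ⊗ A`, which gives a meaning to the axioms for the counit
and the antipode. Because `A ⊗ A` embeds in `M(A ⊗ A)`, these maps are determined by `Δ`; the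
counit `ε` and the antipode `S` are determined by `Δ` as well. -/
structure RegularMultiplierHopfAlgebra (A : Type*) [NonUnitalRing A] [Module ℂ A]
    [IsScalarTower ℂ A A] [SMulCommClass ℂ A A] where
  nonDegenerate : NonDegenerate A
  /-- The coproduct, a homomorphism from `A` to `M(A ⊗ A)`. -/
  Δ : A →ₙₐ[ℂ] Multiplier (A ⊗[ℂ] A)
  /-- The coproduct is non-degenerate: `Δ(A)(A ⊗ A)` spans `A ⊗ A`, -/
  span_left : Submodule.span ℂ {z | ∃ (a : A) (x : A ⊗[ℂ] A), z = (Δ a).left x} = ⊤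
  /-- and so does `(A ⊗ A)Δ(A)`. -/
  span_right : Submodule.span ℂ {z | ∃ (a : A) (x : A ⊗[ℂ] A), z = (Δ a).right x} = ⊤
  /-- `T₁ (a ⊗ b) = Δ(a)(1 ⊗ b)` -/
  T₁ : A ⊗[ℂ] A →ₗ[ℂ] A ⊗[ℂ] A
  incl_T₁ : ∀ a b : A, Multiplier.incl (T₁ (a ⊗ₜ b)) = Δ a * inSnd b
  /-- `T₂ (a ⊗ b) = (a ⊗ 1)Δ(b)` -/
  T₂ : A ⊗[ℂ] A →ₗ[ℂ] A ⊗[ℂ] A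
  incl_T₂ : ∀ a b : A, Multiplier.incl (T₂ (a ⊗ₜ b)) = inFst a * Δ b
  /-- `T₃ (a ⊗ b) = Δ(a)(b ⊗ 1)` -/
  T₃ : A ⊗[ℂ] A →ₗ[ℂ] A ⊗[ℂ] A
  incl_T₃ : ∀ a b : A, Multiplier.incl (T₃ (a ⊗ₜ b)) = Δ a * inFst b
  /-- `T₄ (a ⊗ b) = (1 ⊗ a)Δ(b)` -/
  T₄ : A ⊗[ℂ] A →ₗ[ℂ] A ⊗[ℂ] A
  incl_T₄ : ∀ a b : A, Multiplier.incl (T₄ (a ⊗ₜ b)) = inSnd a * Δ b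
  /-- Coassociativity:
  `(a ⊗ 1 ⊗ 1)(Δ ⊗ ι)(Δ(b)(1 ⊗ c)) = (ι ⊗ Δ)((a ⊗ 1)Δ(b))(1 ⊗ 1 ⊗ c)` in `A ⊗ A ⊗ A`. The left
  hand side is `T₂ ⊗ ι` applied to `a ⊗ Δ(b)(1 ⊗ c)`, and the right hand side is `ι ⊗ T₁` applied
  to `(a ⊗ 1)Δ(b) ⊗ c`. -/
  coassoc : ∀ a b c : A,
    TensorProduct.assoc ℂ A A A
      (T₂.rTensor A ((TensorProduct.assoc ℂ A A A).symm (a ⊗ₜ[ℂ] T₁ (b ⊗ₜ c)))) =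
    T₁.lTensor A (TensorProduct.assoc ℂ A A A (T₂ (a ⊗ₜ b) ⊗ₜ[ℂ] c))
  /-- The counit, a homomorphism from `A` to the complex numbers. -/
  ε : A →ₙₐ[ℂ] ℂ
  /-- `(ε ⊗ ι)(Δ(a)(1 ⊗ b)) = ab` -/
  counit_left : ∀ a b : A, evalFst (ε : A →ₗ[ℂ] ℂ) (T₁ (a ⊗ₜ b)) = a * b
  /-- `(ι ⊗ ε)((a ⊗ 1)Δ(b)) = ab` -/
  counit_right : ∀ a b : A, evalSnd (ε : A →ₗ[ℂ] ℂ) (T₂ (a ⊗ₜ b)) = a * b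
  /-- The antipode, an invertible anti-homomorphism from `A` to `A`. -/
  S : A ≃ₗ[ℂ] A
  S_mul : ∀ a b : A, S (a * b) = S b * S a
  /-- `m(S ⊗ ι)(Δ(a)(1 ⊗ b)) = ε(a)b` -/
  antipode_left : ∀ a b : A,
    LinearMap.mul' ℂ A (S.toLinearMap.rTensor A (T₁ (a ⊗ₜ b))) = ε a • b
  /-- `m(ι ⊗ S)((a ⊗ 1)Δ(b)) = ε(b)a` -/
  antipode_right : ∀ a b : A,
    LinearMap.mul' ℂ A (S.toLinearMap.lTensor A (T₂ (a ⊗ₜ b))) = ε b • a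

namespace RegularMultiplierHopfAlgebra

variable {A : Type*} [NonUnitalRing A] [Module ℂ A] [IsScalarTower ℂ A A] [SMulCommClass ℂ A A]

theorem incl_inj (H : RegularMultiplierHopfAlgebra A) {x y : A ⊗[ℂ] A} (h : Multiplier.incl x = Multiplier.incl y) : x = y :=
  Multiplier.incl_injective H.nonDegenerate.tensor h

theorem inFst_mul (a b : A) : inFst (a * b) = inFst a * inFst b := by
  refine Multiplier.ext (fun x => ?_) (fun x => ?_)
  · rw [Multiplier.left_mul_left]
    induction x with
    | zero => simp
    | add x y hx hy => simp only [map_add, hx, hy]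
    | tmul p q => simp [inFst_left_tmul, mul_assoc]
  · rw [Multiplier.right_mul_right]
    induction x with
    | zero => simp
    | add x y hx hy => simp only [map_add, hx, hy]
    | tmul p q => simp [inFst_right_tmul, mul_assoc]

theorem inSnd_mul (a b : A) : inSnd (a * b) = inSnd a * inSnd b := by
  refine Multiplier.ext (fun x => ?_) (fun x => ?_)
  · rw [Multiplier.left_mul_left]
    induction x with
    | zero => simp
    | add x y hx hy => simp only [map_add, hx, hy]
    | tmul p q => simp [inSnd_left_tmul, mul_assoc]
  · rw [Multiplier.right_mul_right]
    induction x with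
    | zero => simp
    | add x y hx hy => simp only [map_add, hx, hy]
    | tmul p q => simp [inSnd_right_tmul, mul_assoc]

variable (H : RegularMultiplierHopfAlgebra A)

theorem T₁_mul (a b c : A) : H.T₁ (a ⊗ₜ (b * c)) = (inSnd c).right (H.T₁ (a ⊗ₜ b)) :=
  H.incl_inj <| by
    rw [← Multiplier.incl_mul, H.incl_T₁, H.incl_T₁, inSnd_mul, mul_assoc]

theorem T₂_mul (a b c : A) : H.T₂ ((a * b) ⊗ₜ c) = (inFst a).left (H.T₂ (b ⊗ₜ c)) :=
  H.incl_inj <| by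
    rw [← Multiplier.mul_incl, H.incl_T₂, H.incl_T₂, inFst_mul, mul_assoc]

theorem T₃_mul (a b c : A) : H.T₃ (a ⊗ₜ (b * c)) = (inFst c).right (H.T₃ (a ⊗ₜ b)) :=
  H.incl_inj <| by
    rw [← Multiplier.incl_mul, H.incl_T₃, H.incl_T₃, inFst_mul, mul_assoc]

theorem T₄_mul (a b c : A) : H.T₄ ((a * b) ⊗ₜ c) = (inSnd a).left (H.T₄ (b ⊗ₜ c)) :=
  H.incl_inj <| by
    rw [← Multiplier.mul_incl, H.incl_T₄, H.incl_T₄, inSnd_mul, mul_assoc]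

theorem T₂_T₃ (a b c : A) :
    (inFst c).right (H.T₂ (a ⊗ₜ b)) = (inFst a).left (H.T₃ (b ⊗ₜ c)) :=
  H.incl_inj <| by
    rw [← Multiplier.mul_incl, ← Multiplier.incl_mul, H.incl_T₂, H.incl_T₃, mul_assoc]

theorem T₄_T₁ (a b c : A) :
    (inSnd c).right (H.T₄ (a ⊗ₜ b)) = (inSnd a).left (H.T₁ (b ⊗ₜ c)) :=
  H.incl_inj <| by
    rw [← Multiplier.mul_incl, ← Multiplier.incl_mul, H.incl_T₄, H.incl_T₁, mul_assoc]

/-- The multiplier `(ι ⊗ f)Δ(a)` of `A`, for a linear functional `f`: it is defined by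
`((ι ⊗ f)Δ(a)) b = (ι ⊗ f)(Δ(a)(b ⊗ 1))` and `b ((ι ⊗ f)Δ(a)) = (ι ⊗ f)((b ⊗ 1)Δ(a))`. -/
def sliceSnd (f : A →ₗ[ℂ] ℂ) (a : A) : Multiplier A :=
  Multiplier.mk (evalSnd f ∘ₗ H.T₃ ∘ₗ TensorProduct.mk ℂ A A a)
    (evalSnd f ∘ₗ H.T₂ ∘ₗ (TensorProduct.mk ℂ A A).flip a)
    (fun x y => by simp [T₃_mul, evalSnd_inFst_right])
    (fun x y => by simp [T₂_mul, evalSnd_inFst_left])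
    (fun x y => by simp [← evalSnd_inFst_right, ← evalSnd_inFst_left, T₂_T₃])

/-- The multiplier `(f ⊗ ι)Δ(a)` of `A`, for a linear functional `f`: it is defined by
`((f ⊗ ι)Δ(a)) b = (f ⊗ ι)(Δ(a)(1 ⊗ b))` and `b ((f ⊗ ι)Δ(a)) = (f ⊗ ι)((1 ⊗ b)Δ(a))`. -/
def sliceFst (f : A →ₗ[ℂ] ℂ) (a : A) : Multiplier A :=
  Multiplier.mk (evalFst f ∘ₗ H.T₁ ∘ₗ TensorProduct.mk ℂ A A a)
    (evalFst f ∘ₗ H.T₄ ∘ₗ (TensorProduct.mk ℂ A A).flip a)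
    (fun x y => by simp [T₁_mul, evalFst_inSnd_right])
    (fun x y => by simp [T₄_mul, evalFst_inSnd_left])
    (fun x y => by simp [← evalFst_inSnd_right, ← evalFst_inSnd_left, T₄_T₁])

/-- A left integral: a non-zero linear functional with `(ι ⊗ φ)Δ(a) = φ(a)1` in `M(A)`. -/
structure IsLeftIntegral (φ : A →ₗ[ℂ] ℂ) : Prop where
  ne_zero : φ ≠ 0
  invariant : ∀ a : A, H.sliceSnd φ a = φ a • (1 : Multiplier A)

/-- A right integral: a non-zero linear functional with `(ψ ⊗ ι)Δ(a) = ψ(a)1` in `M(A)`. -/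
structure IsRightIntegral (ψ : A →ₗ[ℂ] ℂ) : Prop where
  ne_zero : ψ ≠ 0
  invariant : ∀ a : A, H.sliceFst ψ a = ψ a • (1 : Multiplier A)

/-- The multiplier `δ` is the modular element: `(φ ⊗ ι)Δ(a) = φ(a)δ` for all `a`, where `φ` is a
left integral. -/
def IsModularElement (φ : A →ₗ[ℂ] ℂ) (δ : Multiplier A) : Prop :=
  ∀ a : A, H.sliceFst φ a = φ a • δ

/-- The automorphism `S²` of `A`. -/
def sqS : AlgAut A where
  toLinearEquiv := H.S.trans H.S
  map_mul' a b := by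
    change H.S (H.S (a * b)) = H.S (H.S a) * H.S (H.S b)
    rw [H.S_mul, H.S_mul]

end RegularMultiplierHopfAlgebra

/-- The automorphism `σ` is the modular automorphism of the functional `f`:
`f(ab) = f(bσ(a))` for all `a` and `b`. -/
def IsModularAutomorphism {A : Type*} [NonUnitalRing A] [Module ℂ A] (f : A →ₗ[ℂ] ℂ)
    (σ : AlgAut A) : Prop :=
  ∀ a b : A, f (a * b) = f (b * σ a)

end AlgQuantumGroup

end

/-! The key is strong left invariance: evaluating `S(a₁)a₂b₁ φ(a₃b₂)` with the antipode axiom on the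
one hand and with the left invariance of `φ` on the other gives
`S((ι ⊗ φ)(Δ(a)(1 ⊗ b))) = (ι ⊗ φ)((1 ⊗ a)Δ(b))`. Applied twice, with `φ(ab) = φ(bσ(a))` used to
pass from the right hand side back to the left hand side, it yields `Δ(σ(a)) = (S² ⊗ σ)Δ(a)` once
`φ` is known to be faithful. It also shows that `φ((ψ ∘ S⁻¹ ⊗ ι)((1 ⊗ b)Δ(a))) = ψ(b)φ(a)`, so that
`ψ` is proportional to `φ ∘ S = φ(· δ)`. Hence `σ'` is the modular automorphism of `φ ∘ S` and of
`φ(· δ)`, and expressing these two facts through `σ` gives the remaining two formulas.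
-/

namespace AlgQuantumGroup

section NonDegenerate

variable {B : Type*} [NonUnitalRing B]

theorem NonDegenerate.eq_of_forall_mul_left (hB : NonDegenerate B) {a b : B}
    (h : ∀ c, c * a = c * b) : a = b :=
  sub_eq_zero.mp <| hB.eq_zero_of_mul_right _ fun c => by rw [mul_sub, h, sub_self]

theorem NonDegenerate.eq_of_forall_mul_right (hB : NonDegenerate B) {a b : B}
    (h : ∀ c, a * c = b * c) : a = b :=
  sub_eq_zero.mp <| hB.eq_zero_of_mul_left _ fun c => by rw [sub_mul, h, sub_self]

variable [Module ℂ B] [IsScalarTower ℂ B B] [SMulCommClass ℂ B B]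

theorem Multiplier.ext_right (hB : NonDegenerate B) {m n : Multiplier B}
    (h : m.right = n.right) : m = n :=
  Multiplier.ext (fun y => hB.eq_of_forall_mul_left fun x => by
    rw [← Multiplier.right_mul, ← Multiplier.right_mul, h]) (LinearMap.congr_fun h)

theorem AlgAut.extend_right_apply (θ : AlgAut B) (m : Multiplier B) (x : B) :
    (θ.extend m).right (θ x) = θ (m.right x) :=
  congrArg (fun y => θ (m.right y)) (θ.toLinearEquiv.symm_apply_apply x)

end NonDegenerate

section Slices

variable {A : Type*} [NonUnitalRing A] [Module ℂ A]

theorem evalFst_smul (k : ℂ) (f : A →ₗ[ℂ] ℂ) (x : A ⊗[ℂ] A) :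
    evalFst (k • f) x = k • evalFst f x := by
  rw [evalFst, LinearMap.rTensor_smul, LinearMap.comp_smul]
  rfl

theorem apply_evalSnd (f g : A →ₗ[ℂ] ℂ) (x : A ⊗[ℂ] A) :
    g (evalSnd f x) = f (evalFst g x) := by
  induction x with
  | zero => simp
  | add x y hx hy => simp only [map_add, hx, hy]
  | tmul p q => simp [evalSnd, evalFst, mul_comm]

theorem eq_sum_tmul_evalFst {ι : Type*} (b : Module.Basis ι ℂ A) (x : A ⊗[ℂ] A) :
    ∃ s : Finset ι, x = ∑ i ∈ s, b i ⊗ₜ[ℂ] evalFst (b.coord i) x := by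
  classical
  let e := TensorProduct.equivFinsuppOfBasisLeft (N := A) b
  refine ⟨(e x).support, ?_⟩
  calc x = e.symm (e x) := (e.symm_apply_apply x).symm
    _ = ∑ i ∈ (e x).support, b i ⊗ₜ[ℂ] e x i :=
      TensorProduct.equivFinsuppOfBasisLeft_symm_apply b (e x)
    _ = ∑ i ∈ (e x).support, b i ⊗ₜ[ℂ] evalFst (b.coord i) x :=
      Finset.sum_congr rfl fun i _ => congrArg (b i ⊗ₜ[ℂ] ·)
        (TensorProduct.equivFinsuppOfBasisLeft_apply b x i)

theorem lTensor_evalSnd_assoc (f : A →ₗ[ℂ] ℂ) (x : A ⊗[ℂ] A) (s : A) :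
    (evalSnd f).lTensor A (TensorProduct.assoc ℂ A A A (x ⊗ₜ s)) = f s • x := by
  induction x with
  | zero => simp only [TensorProduct.zero_tmul, map_zero, smul_zero]
  | add x y hx hy => simp only [map_add, TensorProduct.add_tmul, hx, hy, smul_add]
  | tmul p q => simp [evalSnd]

variable [IsScalarTower ℂ A A] [SMulCommClass ℂ A A]

theorem incl_tmul (a b : A) : Multiplier.incl (a ⊗ₜ[ℂ] b) = inFst a * inSnd b :=
  Multiplier.ext (tmul_tmul_eq_left a b) (tmul_tmul_eq_right a b)

theorem evalSnd_inSnd_right (f : A →ₗ[ℂ] ℂ) (b : A) (x : A ⊗[ℂ] A) :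
    evalSnd f ((inSnd b).right x) = evalSnd (f ∘ₗ LinearMap.mulRight ℂ b) x := by
  induction x with
  | zero => simp only [map_zero]
  | add x y hx hy => simp only [map_add, hx, hy]
  | tmul p q => simp [inSnd_right_tmul]

theorem evalSnd_inSnd_left (f : A →ₗ[ℂ] ℂ) (b : A) (x : A ⊗[ℂ] A) :
    evalSnd f ((inSnd b).left x) = evalSnd (f ∘ₗ LinearMap.mulLeft ℂ b) x := by
  induction x with
  | zero => simp only [map_zero]
  | add x y hx hy => simp only [map_add, hx, hy]
  | tmul p q => simp [inSnd_left_tmul]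

theorem NonDegenerate.eq_of_forall_inFst_left (hA : NonDegenerate A) {x y : A ⊗[ℂ] A}
    (h : ∀ d : A, (inFst d).left x = (inFst d).left y) : x = y :=
  sub_eq_zero.mp <| eq_zero_of_evalSnd fun f => hA.eq_zero_of_mul_right _ fun d => by
    rw [← evalSnd_inFst_left, map_sub, h, sub_self, map_zero]

theorem apply_mul_evalFst (f g : A →ₗ[ℂ] ℂ) (b : A) (x : A ⊗[ℂ] A) :
    f (b * evalFst g x) = g (evalSnd f ((inSnd b).left x)) := by
  rw [← evalFst_inSnd_left, apply_evalSnd]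

theorem apply_mul'_rTensor_eq_zero {f : A →ₗ[ℂ] ℂ} (T : A →ₗ[ℂ] A) {x : A ⊗[ℂ] A}
    (h : ∀ b, evalSnd f ((inSnd b).left x) = 0) :
    f (LinearMap.mul' ℂ A (T.rTensor A x)) = 0 := by
  obtain ⟨s, hs⟩ := eq_sum_tmul_evalFst (Module.Free.chooseBasis ℂ A) x
  rw [hs, map_sum, map_sum, map_sum]
  refine Finset.sum_eq_zero fun i _ => ?_
  rw [LinearMap.rTensor_tmul, LinearMap.mul'_apply, apply_mul_evalFst, h, map_zero]

theorem AlgAut.tensor_tmul (α β : AlgAut A) (a b : A) :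
    (α.tensor β) (a ⊗ₜ[ℂ] b) = α a ⊗ₜ β b := rfl

theorem AlgAut.tensor_inFst_left (α β : AlgAut A) (b : A) (x : A ⊗[ℂ] A) :
    (α.tensor β) ((inFst b).left x) = (inFst (α b)).left ((α.tensor β) x) := by
  induction x with
  | zero => simp only [map_zero]
  | add x y hx hy => simp only [map_add, hx, hy]
  | tmul p q => simp only [inFst_left_tmul, AlgAut.tensor_tmul, AlgAut.map_mul]

namespace IsModularAutomorphism

variable {φ : A →ₗ[ℂ] ℂ} {σ : AlgAut A} (hσ : IsModularAutomorphism φ σ)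
include hσ

theorem evalSnd_inSnd_right_eq_left (c : A) (x : A ⊗[ℂ] A) :
    evalSnd φ ((inSnd (σ c)).right x) = evalSnd φ ((inSnd c).left x) := by
  rw [evalSnd_inSnd_right, evalSnd_inSnd_left]
  exact congrArg (evalSnd · x) (LinearMap.ext fun y => (hσ c y).symm)

theorem evalSnd_inSnd_left_tensor (α : AlgAut A) (b : A) (x : A ⊗[ℂ] A) :
    evalSnd φ ((inSnd b).left ((α.tensor σ) x)) = α (evalSnd φ ((inSnd b).right x)) := by
  induction x with
  | zero => simp only [map_zero]
  | add x y hx hy => simp only [map_add, hx, hy]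
  | tmul p q =>
    rw [AlgAut.tensor_tmul, inSnd_left_tmul, inSnd_right_tmul, evalSnd_tmul, evalSnd_tmul, hσ q b,
      map_smul]

end IsModularAutomorphism

end Slices

namespace RegularMultiplierHopfAlgebra

variable {A : Type*} [NonUnitalRing A] [Module ℂ A] [IsScalarTower ℂ A A] [SMulCommClass ℂ A A]
  (H : RegularMultiplierHopfAlgebra A)

theorem inFst_left_T₁ (d a b : A) :
    (inFst d).left (H.T₁ (a ⊗ₜ b)) = (inSnd b).right (H.T₂ (d ⊗ₜ a)) :=
  H.incl_inj <| by
    rw [← Multiplier.mul_incl, ← Multiplier.incl_mul, H.incl_T₁, H.incl_T₂, mul_assoc]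

theorem inFst_left_T₄ (d c a : A) :
    (inFst d).left (H.T₄ (c ⊗ₜ a)) = (inSnd c).left (H.T₂ (d ⊗ₜ a)) :=
  H.incl_inj <| by
    rw [← Multiplier.mul_incl, ← Multiplier.mul_incl, H.incl_T₄, H.incl_T₂, ← mul_assoc,
      ← mul_assoc, inFst_inSnd_comm]

theorem inSnd_left_T₃ (a b c : A) :
    (inSnd a).left (H.T₃ (b ⊗ₜ c)) = (inFst c).right (H.T₄ (a ⊗ₜ b)) :=
  H.incl_inj <| by
    rw [← Multiplier.mul_incl, ← Multiplier.incl_mul, H.incl_T₄, H.incl_T₃, mul_assoc]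

theorem comul_left_T₃ (v b c : A) :
    (H.Δ v).left (H.T₃ (b ⊗ₜ c)) = H.T₃ ((v * b) ⊗ₜ c) :=
  H.incl_inj <| by
    rw [← Multiplier.mul_incl, H.incl_T₃, H.incl_T₃, map_mul, mul_assoc]

theorem comul_left_tmul (v r s : A) :
    (H.Δ v).left (r ⊗ₜ s) = (inFst r).right (H.T₁ (v ⊗ₜ s)) :=
  H.incl_inj <| by
    rw [← Multiplier.mul_incl, ← Multiplier.incl_mul, H.incl_T₁, incl_tmul, inFst_inSnd_comm,
      mul_assoc]

theorem comul_right_tmul (a b c : A) :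
    (H.Δ a).right (b ⊗ₜ c) = (inFst b).left (H.T₄ (c ⊗ₜ a)) :=
  H.incl_inj <| by
    rw [← Multiplier.mul_incl, ← Multiplier.incl_mul, H.incl_T₄, incl_tmul, mul_assoc]

theorem mul_evalSnd_T₁ (f : A →ₗ[ℂ] ℂ) (d a b : A) :
    d * evalSnd f (H.T₁ (a ⊗ₜ b)) = evalSnd (f ∘ₗ LinearMap.mulRight ℂ b) (H.T₂ (d ⊗ₜ a)) := by
  rw [← evalSnd_inFst_left, inFst_left_T₁, evalSnd_inSnd_right]

theorem mul_evalSnd_T₄ (f : A →ₗ[ℂ] ℂ) (d a b : A) :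
    d * evalSnd f (H.T₄ (a ⊗ₜ b)) = evalSnd f ((inSnd a).left (H.T₂ (d ⊗ₜ b))) := by
  rw [← evalSnd_inFst_left, inFst_left_T₄]

theorem counit_evalSnd_T₁ (f : A →ₗ[ℂ] ℂ) (a b : A) :
    H.ε (evalSnd f (H.T₁ (a ⊗ₜ b))) = f (a * b) := by
  rw [← H.counit_left, ← apply_evalSnd]
  rfl

theorem evalSnd_counit_T₄ (c a : A) :
    evalSnd (H.ε : A →ₗ[ℂ] ℂ) (H.T₄ (c ⊗ₜ a)) = H.ε c • a :=
  H.nonDegenerate.eq_of_forall_mul_left fun d => by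
    have hmul (x : A ⊗[ℂ] A) : evalSnd (H.ε : A →ₗ[ℂ] ℂ) ((inSnd c).left x) =
        H.ε c • evalSnd (H.ε : A →ₗ[ℂ] ℂ) x := by
      induction x with
      | zero => simp only [map_zero, smul_zero]
      | add x y hx hy => simp only [map_add, hx, hy, smul_add]
      | tmul p q => simp [inSnd_left_tmul, mul_smul]
    rw [mul_evalSnd_T₄, hmul, counit_right, mul_smul_comm]

theorem counit_sliceFst_right (f : A →ₗ[ℂ] ℂ) (a c : A) :
    H.ε ((H.sliceFst f a).right c) = H.ε c * f a := by
  have h := apply_evalSnd (H.ε : A →ₗ[ℂ] ℂ) f (H.T₄ (c ⊗ₜ a))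
  rw [evalSnd_counit_T₄, map_smul, smul_eq_mul] at h
  exact h.symm

theorem counit_ne_zero [Nontrivial A] : (H.ε : A →ₗ[ℂ] ℂ) ≠ 0 := by
  intro hε
  obtain ⟨a, ha⟩ := exists_ne (0 : A)
  refine ha (H.nonDegenerate.eq_zero_of_mul_left a fun b => ?_)
  simp [← H.counit_left, hε, evalFst]

/-- Coassociativity with a functional applied to the third leg. -/
theorem T₂_evalSnd_T₁ (f : A →ₗ[ℂ] ℂ) (d a s : A) :
    H.T₂ (d ⊗ₜ evalSnd f (H.T₁ (a ⊗ₜ s))) =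
      (evalSnd f ∘ₗ H.T₁ ∘ₗ (TensorProduct.mk ℂ A A).flip s).lTensor A (H.T₂ (d ⊗ₜ a)) := by
  have slice_left (x : A ⊗[ℂ] A) : (evalSnd f).lTensor A (TensorProduct.assoc ℂ A A A
      (H.T₂.rTensor A ((TensorProduct.assoc ℂ A A A).symm (d ⊗ₜ[ℂ] x)))) =
      H.T₂ (d ⊗ₜ evalSnd f x) := by
    induction x with
    | zero => simp only [map_zero, TensorProduct.tmul_zero]
    | add x y hx hy => simp only [map_add, TensorProduct.tmul_add, hx, hy]
    | tmul p q =>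
      rw [TensorProduct.assoc_symm_tmul, LinearMap.rTensor_tmul, lTensor_evalSnd_assoc,
        evalSnd_tmul, TensorProduct.tmul_smul, map_smul]
  have slice_right (y : A ⊗[ℂ] A) : (evalSnd f).lTensor A (H.T₁.lTensor A
      (TensorProduct.assoc ℂ A A A (y ⊗ₜ[ℂ] s))) =
      (evalSnd f ∘ₗ H.T₁ ∘ₗ (TensorProduct.mk ℂ A A).flip s).lTensor A y := by
    induction y with
    | zero => simp only [map_zero, TensorProduct.zero_tmul]
    | add x y hx hy => simp only [map_add, TensorProduct.add_tmul, hx, hy]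
    | tmul p q => rfl
  rw [← slice_left, H.coassoc, slice_right]

/-- The linear map `v ↦ Δ(v)x`, depending linearly on `x`. -/
noncomputable def comulMul : A ⊗[ℂ] A →ₗ[ℂ] A →ₗ[ℂ] A ⊗[ℂ] A :=
  (LinearMap.fst ℂ _ _ ∘ₗ (multiplierSubalgebra (A ⊗[ℂ] A)).val.toLinearMap ∘ₗ
    (H.Δ : A →ₗ[ℂ] Multiplier (A ⊗[ℂ] A))).flip

theorem comulMul_apply (x : A ⊗[ℂ] A) (v : A) : H.comulMul x v = (H.Δ v).left x := rfl

/-- The map `x ↦ (ι ⊗ ι ⊗ f)(Δ⁽²⁾(a)(1 ⊗ x))`, where `Δ⁽²⁾ = (Δ ⊗ ι)Δ`: on `r ⊗ s` it is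
`Δ((ι ⊗ f)(Δ(a)(1 ⊗ s)))(1 ⊗ r)`, which lies in `A ⊗ A`. -/
noncomputable def comul₂Slice (f : A →ₗ[ℂ] ℂ) (a : A) : A ⊗[ℂ] A →ₗ[ℂ] A ⊗[ℂ] A :=
  H.T₁ ∘ₗ (TensorProduct.comm ℂ A A).toLinearMap ∘ₗ
    (evalSnd f ∘ₗ H.T₁ ∘ₗ TensorProduct.mk ℂ A A a).lTensor A

theorem comul₂Slice_tmul (f : A →ₗ[ℂ] ℂ) (a r s : A) :
    H.comul₂Slice f a (r ⊗ₜ s) = H.T₁ (evalSnd f (H.T₁ (a ⊗ₜ s)) ⊗ₜ r) := rfl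

theorem inFst_left_comul₂Slice (f : A →ₗ[ℂ] ℂ) (d a : A) (x : A ⊗[ℂ] A) :
    (inFst d).left (H.comul₂Slice f a x) =
      (evalSnd f ∘ₗ H.comulMul x).lTensor A (H.T₂ (d ⊗ₜ a)) := by
  induction x with
  | zero => simp only [map_zero, LinearMap.comp_zero, LinearMap.lTensor_zero, LinearMap.zero_apply]
  | add x y hx hy =>
    simp only [map_add, hx, hy, LinearMap.comp_add, LinearMap.lTensor_add, LinearMap.add_apply]
  | tmul r s =>
    have hrs : evalSnd f ∘ₗ H.comulMul (r ⊗ₜ s) = LinearMap.mulRight ℂ r ∘ₗ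
        evalSnd f ∘ₗ H.T₁ ∘ₗ (TensorProduct.mk ℂ A A).flip s := by
      ext v
      simp [comulMul_apply, comul_left_tmul, evalSnd_inFst_right]
    rw [comul₂Slice_tmul, inFst_left_T₁, T₂_evalSnd_T₁, hrs,
      LinearMap.lTensor_comp A (LinearMap.mulRight ℂ r)]
    rfl

theorem mul'_antipode_comul₂Slice (f : A →ₗ[ℂ] ℂ) (a : A) (x : A ⊗[ℂ] A) :
    LinearMap.mul' ℂ A (H.S.toLinearMap.rTensor A (H.comul₂Slice f a x)) =
      evalSnd f ((inSnd a).left x) := by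
  induction x with
  | zero => simp only [map_zero]
  | add x y hx hy => simp only [map_add, hx, hy]
  | tmul r s =>
    rw [comul₂Slice_tmul, antipode_left, counit_evalSnd_T₁, inSnd_left_tmul, evalSnd_tmul]

theorem evalSnd_T₁_modular {f : A →ₗ[ℂ] ℂ} {σ : AlgAut A} (hσ : IsModularAutomorphism f σ)
    (a b : A) : evalSnd f (H.T₁ (b ⊗ₜ σ a)) = evalSnd f (H.T₄ (a ⊗ₜ b)) :=
  H.nonDegenerate.eq_of_forall_mul_left fun d => by
    rw [mul_evalSnd_T₁, mul_evalSnd_T₄, ← evalSnd_inSnd_right, hσ.evalSnd_inSnd_right_eq_left]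

variable {H}

theorem IsRightIntegral.evalFst_T₁ {ψ : A →ₗ[ℂ] ℂ} (hψ : H.IsRightIntegral ψ) (a b : A) :
    evalFst ψ (H.T₁ (a ⊗ₜ b)) = ψ a • b :=
  congrArg (fun m : Multiplier A => m.left b) (hψ.invariant a)

theorem IsRightIntegral.smul {ψ : A →ₗ[ℂ] ℂ} (hψ : H.IsRightIntegral ψ) {k : ℂ} (hk : k ≠ 0) :
    H.IsRightIntegral (k • ψ) where
  ne_zero := smul_ne_zero hk hψ.ne_zero
  invariant a := by
    rw [LinearMap.smul_apply, smul_assoc, ← hψ.invariant]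
    exact Multiplier.ext (fun b => evalFst_smul k ψ _) fun b => evalFst_smul k ψ _

namespace IsLeftIntegral

variable {φ : A →ₗ[ℂ] ℂ} (hφ : H.IsLeftIntegral φ)
include hφ

theorem evalSnd_T₃ (a b : A) : evalSnd φ (H.T₃ (a ⊗ₜ b)) = φ a • b :=
  congrArg (fun m : Multiplier A => m.left b) (hφ.invariant a)

theorem comul₂Slice_T₃ (a b c : A) :
    H.comul₂Slice φ a (H.T₃ (b ⊗ₜ c)) = evalSnd φ (H.T₁ (a ⊗ₜ b)) ⊗ₜ c := by
  refine H.nonDegenerate.eq_of_forall_inFst_left fun d => ?_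
  rw [inFst_left_comul₂Slice, inFst_left_tmul, mul_evalSnd_T₁]
  have slice (y : A ⊗[ℂ] A) : (evalSnd φ ∘ₗ H.comulMul (H.T₃ (b ⊗ₜ c))).lTensor A y =
      evalSnd (φ ∘ₗ LinearMap.mulRight ℂ b) y ⊗ₜ c := by
    induction y with
    | zero => simp only [map_zero, TensorProduct.zero_tmul]
    | add x y hx hy => simp only [map_add, TensorProduct.add_tmul, hx, hy]
    | tmul u v => simp [comulMul_apply, comul_left_T₃, hφ.evalSnd_T₃, TensorProduct.smul_tmul]
  exact slice _

/-- Strong left invariance of `φ`. -/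
theorem antipode_evalSnd_T₁ (a b : A) :
    H.S (evalSnd φ (H.T₁ (a ⊗ₜ b))) = evalSnd φ (H.T₄ (a ⊗ₜ b)) := by
  refine H.nonDegenerate.eq_of_forall_mul_right fun c => ?_
  calc H.S (evalSnd φ (H.T₁ (a ⊗ₜ b))) * c
      = LinearMap.mul' ℂ A (H.S.toLinearMap.rTensor A (H.comul₂Slice φ a (H.T₃ (b ⊗ₜ c)))) := by
        rw [hφ.comul₂Slice_T₃]; rfl
    _ = evalSnd φ ((inSnd a).left (H.T₃ (b ⊗ₜ c))) := H.mul'_antipode_comul₂Slice φ a _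
    _ = evalSnd φ (H.T₄ (a ⊗ₜ b)) * c := by rw [inSnd_left_T₃, evalSnd_inFst_right]

theorem evalSnd_T₄_eq_zero {a : A} (ha : ∀ b, φ (b * a) = 0) (b : A) :
    evalSnd φ (H.T₄ (b ⊗ₜ a)) = 0 := by
  have hφa : φ ∘ₗ LinearMap.mulRight ℂ a = 0 := LinearMap.ext ha
  have hT₁ : evalSnd φ (H.T₁ (b ⊗ₜ a)) = 0 := H.nonDegenerate.eq_zero_of_mul_right _ fun d => by
    rw [mul_evalSnd_T₁, hφa, evalSnd, LinearMap.lTensor_zero, LinearMap.comp_zero,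
      LinearMap.zero_apply]
  rw [← hφ.antipode_evalSnd_T₁, hT₁, map_zero]

theorem apply_sliceFst_right {f : A →ₗ[ℂ] ℂ} (hf : H.IsRightIntegral (f ∘ₗ H.S.toLinearMap))
    (a b : A) : φ ((H.sliceFst f a).right b) = f (H.S b) * φ a := by
  calc φ ((H.sliceFst f a).right b) = f (evalSnd φ (H.T₄ (b ⊗ₜ a))) := (apply_evalSnd φ f _).symm
    _ = (f ∘ₗ H.S.toLinearMap) (evalSnd φ (H.T₁ (b ⊗ₜ a))) := by
        rw [← hφ.antipode_evalSnd_T₁]; rfl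
    _ = φ (evalFst (f ∘ₗ H.S.toLinearMap) (H.T₁ (b ⊗ₜ a))) := apply_evalSnd φ _ _
    _ = f (H.S b) * φ a := by rw [hf.evalFst_T₁, map_smul]; rfl

theorem nontrivial : Nontrivial A := by
  by_contra h
  rw [not_nontrivial_iff_subsingleton] at h
  exact hφ.ne_zero (Subsingleton.elim _ _)

variable {σ : AlgAut A} (hσ : IsModularAutomorphism φ σ)
include hσ

theorem counit_eq_zero {a : A} (ha : ∀ b, φ (b * a) = 0) : H.ε a = 0 := by
  obtain ⟨c, hc⟩ := LinearMap.surjective hφ.ne_zero 1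
  obtain ⟨c, rfl⟩ := σ.toLinearEquiv.surjective c
  have slice (b : A) : evalSnd φ ((inSnd b).left (H.T₁ (a ⊗ₜ σ c))) = 0 := by
    rw [← T₄_T₁, hσ.evalSnd_inSnd_right_eq_left, ← T₄_mul, hφ.evalSnd_T₄_eq_zero ha]
  have h := apply_mul'_rTensor_eq_zero H.S.toLinearMap slice
  rwa [antipode_left, map_smul, hc, smul_eq_mul, mul_one] at h

theorem faithful {a : A} (ha : ∀ b, φ (b * a) = 0) : a = 0 := by
  refine H.nonDegenerate.eq_zero_of_mul_right a fun d => ?_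
  refine (Module.forall_dual_apply_eq_zero_iff ℂ _).mp fun g => ?_
  rw [← H.counit_right, apply_evalSnd]
  refine hφ.counit_eq_zero hσ fun b => ?_
  rw [apply_mul_evalFst, ← mul_evalSnd_T₄, hφ.evalSnd_T₄_eq_zero ha, mul_zero, map_zero]

theorem eq_of_forall_mul {a a' : A} (h : ∀ b, φ (b * a) = φ (b * a')) : a = a' :=
  sub_eq_zero.mp <| hφ.faithful hσ fun b => by rw [mul_sub, map_sub, h, sub_self]

theorem eq_of_forall_evalSnd_inSnd_left {x y : A ⊗[ℂ] A}
    (h : ∀ b, evalSnd φ ((inSnd b).left x) = evalSnd φ ((inSnd b).left y)) : x = y :=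
  sub_eq_zero.mp <| eq_zero_of_evalFst fun g => hφ.faithful hσ fun b => by
    rw [apply_mul_evalFst, map_sub, map_sub, h, sub_self, map_zero]

theorem T₄_modular (c a : A) :
    H.T₄ (σ c ⊗ₜ σ a) = (H.sqS.tensor σ) (H.T₄ (c ⊗ₜ a)) := by
  refine hφ.eq_of_forall_evalSnd_inSnd_left hσ fun b => ?_
  calc evalSnd φ ((inSnd b).left (H.T₄ (σ c ⊗ₜ σ a)))
      = H.S (evalSnd φ (H.T₁ ((b * σ c) ⊗ₜ σ a))) := by rw [← T₄_mul, ← hφ.antipode_evalSnd_T₁]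
    _ = H.S (H.S (evalSnd φ (H.T₁ (a ⊗ₜ (b * σ c))))) := by
        rw [H.evalSnd_T₁_modular hσ, ← hφ.antipode_evalSnd_T₁]
    _ = H.S (H.S (evalSnd φ ((inSnd b).right (H.T₄ (c ⊗ₜ a))))) := by
        rw [T₁_mul, hσ.evalSnd_inSnd_right_eq_left, ← T₄_T₁]
    _ = evalSnd φ ((inSnd b).left ((H.sqS.tensor σ) (H.T₄ (c ⊗ₜ a)))) :=
        (hσ.evalSnd_inSnd_left_tensor H.sqS b _).symm

theorem comul_modular (a : A) : H.Δ (σ a) = (H.sqS.tensor σ).extend (H.Δ a) := by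
  refine Multiplier.ext_right H.nonDegenerate.tensor ?_
  rw [← LinearMap.cancel_right (H.sqS.tensor σ).toLinearEquiv.surjective]
  refine TensorProduct.ext' fun b c => ?_
  calc (H.Δ (σ a)).right (H.sqS b ⊗ₜ σ c)
      = (inFst (H.sqS b)).left ((H.sqS.tensor σ) (H.T₄ (c ⊗ₜ a))) := by
        rw [comul_right_tmul, hφ.T₄_modular hσ]
    _ = (H.sqS.tensor σ) ((H.Δ a).right (b ⊗ₜ c)) := by
        rw [comul_right_tmul, AlgAut.tensor_inFst_left]
    _ = ((H.sqS.tensor σ).extend (H.Δ a)).right ((H.sqS.tensor σ) (b ⊗ₜ c)) :=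
        ((H.sqS.tensor σ).extend_right_apply _ _).symm

theorem eq_smul_of_isRightIntegral_comp_antipode {f : A →ₗ[ℂ] ℂ}
    (hf : H.IsRightIntegral (f ∘ₗ H.S.toLinearMap)) {e : A} (he : φ e = 1) : f = f e • φ := by
  have : Nontrivial A := hφ.nontrivial
  obtain ⟨c, hc⟩ := LinearMap.surjective H.counit_ne_zero 1
  replace hc : H.ε c = 1 := hc
  refine LinearMap.ext fun a => ?_
  have hslice : (H.sliceFst f a).right c = φ a • (H.sliceFst f e).right c :=
    hφ.eq_of_forall_mul hσ fun b => by
      rw [← Multiplier.right_mul_apply, hφ.apply_sliceFst_right hf, mul_smul_comm,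
        ← Multiplier.right_mul_apply, map_smul, hφ.apply_sliceFst_right hf, he, mul_one,
        smul_eq_mul, mul_comm]
  simpa [counit_sliceFst_right, hc, mul_comm] using congrArg H.ε hslice

theorem exists_eq_smul_comp_antipode {ψ : A →ₗ[ℂ] ℂ} (hψ : H.IsRightIntegral ψ) :
    ∃ k : ℂ, k ≠ 0 ∧ ψ = k • (φ ∘ₗ H.S.toLinearMap) := by
  obtain ⟨e, he⟩ := LinearMap.surjective hφ.ne_zero 1
  set f := ψ ∘ₗ H.S.symm.toLinearMap
  have hfS : f ∘ₗ H.S.toLinearMap = ψ := LinearMap.ext fun a =>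
    congrArg ψ (H.S.symm_apply_apply a)
  have hf : f = f e • φ := hφ.eq_smul_of_isRightIntegral_comp_antipode hσ (hfS.symm ▸ hψ) he
  have hψφ : ψ = f e • (φ ∘ₗ H.S.toLinearMap) := by rw [← LinearMap.smul_comp, ← hf, hfS]
  refine ⟨f e, fun hk => hψ.ne_zero ?_, hψφ⟩
  rw [hψφ, hk, zero_smul]

theorem apply_modularElement_right {ψ : A →ₗ[ℂ] ℂ} (hψ : H.IsRightIntegral ψ) {δ : Multiplier A}
    (hδ : H.IsModularElement φ δ) (b : A) : φ (δ.right b) = φ (H.S b) := by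
  obtain ⟨e, he⟩ := LinearMap.surjective hφ.ne_zero 1
  obtain ⟨k, hk, hψφ⟩ := hφ.exists_eq_smul_comp_antipode hσ hψ
  have hφS : H.IsRightIntegral (φ ∘ₗ H.S.toLinearMap) := by
    have hkψ := hψ.smul (inv_ne_zero hk)
    rwa [hψφ, inv_smul_smul₀ hk] at hkψ
  have h := hφ.apply_sliceFst_right hφS e b
  rw [hδ e, he, mul_one, one_smul] at h
  exact h

theorem isModularAutomorphism_comp_antipode {ψ : A →ₗ[ℂ] ℂ} (hψ : H.IsRightIntegral ψ)
    {σ' : AlgAut A} (hσ' : IsModularAutomorphism ψ σ') :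
    IsModularAutomorphism (φ ∘ₗ H.S.toLinearMap) σ' := by
  obtain ⟨k, hk, rfl⟩ := hφ.exists_eq_smul_comp_antipode hσ hψ
  exact fun a b => mul_left_cancel₀ hk (hσ' a b)

end IsLeftIntegral

end RegularMultiplierHopfAlgebra

end AlgQuantumGroup

open AlgQuantumGroup in
theorem proposition3p4 {A : Type*} [NonUnitalRing A] [Module ℂ A] [IsScalarTower ℂ A A]
    [SMulCommClass ℂ A A] (H : RegularMultiplierHopfAlgebra A)
    (φ ψ : A →ₗ[ℂ] ℂ) (hφ : H.IsLeftIntegral φ) (hψ : H.IsRightIntegral ψ)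
    (σ σ' : AlgAut A) (hσ : IsModularAutomorphism φ σ) (hσ' : IsModularAutomorphism ψ σ')
    (δ : Multiplier A) (hδ : H.IsModularElement φ δ) :
    (∀ a : A, σ (H.S (σ' a)) = H.S a) ∧
    (∀ a : A, δ * Multiplier.incl (σ a) = Multiplier.incl (σ' a) * δ) ∧
    (∀ a : A, H.Δ (σ a) = (H.sqS.tensor σ).extend (H.Δ a)) := by
  have hS := hφ.isModularAutomorphism_comp_antipode hσ hψ hσ'
  have hφδ := hφ.apply_modularElement_right hσ hψ hδ
  refine ⟨fun a => ?_, fun a => ?_, hφ.comul_modular hσ⟩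
  · refine hφ.eq_of_forall_mul hσ fun b => ?_
    obtain ⟨b, rfl⟩ := H.S.surjective b
    calc φ (H.S b * σ (H.S (σ' a))) = φ (H.S (b * σ' a)) := by rw [← hσ, H.S_mul]
      _ = φ (H.S (a * b)) := (hS a b).symm
      _ = φ (H.S b * H.S a) := by rw [H.S_mul]
  · rw [Multiplier.mul_incl, Multiplier.incl_mul]
    refine congrArg Multiplier.incl (hφ.eq_of_forall_mul hσ fun b => ?_)
    calc φ (b * δ.left (σ a)) = φ (δ.right (a * b)) := by
          rw [← Multiplier.right_mul, ← hσ, Multiplier.right_mul_apply]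
      _ = φ (δ.right (b * σ' a)) := by rw [hφδ, hφδ]; exact hS a b
      _ = φ (b * δ.right (σ' a)) := by rw [Multiplier.right_mul_apply]
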